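/- Let $G$ be a compact (Hausdorff) abelian group with normalized Haar measure $\nu$ and dual group $\widehat G$, and put $\widehat f(\gamma)=\int_G f\,\overline{\gamma}\,d\nu$. For a finite set $\Gamma\subset\widehat G$ let $C_\Gamma$ be the space of all $f\in C(G)$ (complex valued, sup norm) with $\widehat f(\gamma)=0$ for all $\gamma\notin\Gamma$. For $\xi=(\xi_\gamma)\in\mathbb C^\Gamma$ let $M_\xi\colon C_\Gamma\to\ell_1(\Gamma)$, $M_\xi f=(\xi_\gamma\widehat f(\gamma))_{\gamma\in\Gamma}$. For $1\le\lambda<\infty$, a $\lambda$-embedding is an isomorphic embedding $I$ of Banach spaces with $\|I\|\,\|I^{-1}\|\le\lambda$, where $I^{-1}$ is defined on the range of $I$. An interpolation functor $\mathcal F$ assigns to each complex Banach couple $\vec X=(X_0,X_1)$ a Banach space $\mathcal F(\vec X)$ with continuous inclusions $X_0\cap X_1\subset\mathcal F(\vec X)\subset X_0+X_1$, such that every operator $T\colon\vec X\to\vec Y$ of couples (a linear map $X_0+X_1\to Y_0+Y_1$ whose restrictions $X_j\to Y_j$, $j=0,1$, are defined and bounded) maps $\mathcal F(\vec X)$ boundedly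 into $\mathcal F(\vec Y)$. It is exact if always $\|T\colon\mathcal F(\vec X)\to\mathcal F(\vec Y)\|\le\max_{j=0,1}\|T\colon X_j\to Y_j\|$, and normalized if $\|1\|_{\mathcal F(\mathbb C,\mathbb C)}\le1$. Its fundamental function $\psi_{\mathcal F}(s,t)$, $s,t\ge0$, is the supremum of $\|T\colon\mathcal F(\vec X)\to\mathcal F(\vec Y)\|$ over all Banach couples $\vec X,\vec Y$ and all operators $T\colon\vec X\to\vec Y$ with $\|T\colon X_0\to Y_0\|\le s$ and $\|T\colon X_1\to Y_1\|\le t$. (a) Let $I\colon C_\Gamma\to\ell_\infty^N$ be a $\lambda$-embedding, let $\mathcal F$ be a normalized exact interpolation functor, and let $X=\mathcal F(\ell_1(\Gamma),\ell_2(\Gamma))$. Then for every $\xi\in\mathbb C^\Gamma$ $$\sup_{\|\mu\|_{\ell_2(\Gamma)}\le1}\|(\xi_\gamma\mu_\gamma)_{\gamma\in\Gamma}\|_X\le K\,\psi_{\mathcal F}\big(\|M_\xi\colon C_\Gamma\to\ell_1(\Gamma)\|,\|\xi\|_{\ell_\infty(\Gamma)}\big)\,\psi_{\mathcal F}\big(\sqrt{1+\log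 N},1\big),\qquad K=e^2\lambda\sqrt2\,\psi_{\mathcal F}(1,1).$$ (b) Let $I\colon C_\Gamma\to\ell_\infty^N$ be a $\lambda$-embedding, $\theta\in(0,1)$ and $\frac1{p_\theta}=(1-\theta)+\frac\theta2$. Then for every $\xi\in\mathbb C^\Gamma$ $$\sup_{\|\mu\|_{\ell_2(\Gamma)}\le1}\|(\xi_\gamma\mu_\gamma)\|_{\ell_{p_\theta}(\Gamma)}\le e^2\lambda\sqrt2\,\big(\sqrt{1+\log N}\,\|M_\xi\colon C_\Gamma\to\ell_1(\Gamma)\|\big)^{1-\theta}\|\xi\|_\infty^\theta.$$ (c) Let $m,n\ge1$, let $\Lambda$ be the set of all $\alpha\in\mathbb N_0^n$ with $|\alpha|=\alpha_1+\dots+\alpha_n\le m$, identified with the set of characters $z\mapsto z^\alpha$ of the torus $\mathbb T^n$, so that $\mathcal P_{\le m}(\mathbb T^n):=C_\Lambda$ is the space of analytic polynomials of degree at most $m$ in $n$ variables with the sup norm on $\mathbb T^n$. Then for every $\xi\in\mathbb C^\Lambda$ and $\theta\in(0,1)$, $\frac1{p_\theta}=(1-\theta)+\frac\theta2$, $$\sup_{\|\mu\|_{\ell_2(\Lambda)}\le1}\|(\mu_\alpha\xi_\alpha)\|_{\ell_{p_\theta}(\Lambda)}\le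 2e^2\sqrt2\,\big(\sqrt{n\log(1+20m)}\,\|M_\xi\colon\mathcal P_{\le m}(\mathbb T^n)\to\ell_1(\Lambda)\|\big)^{1-\theta}\|\xi\|_\infty^\theta,$$ and $$\sup_{\|\mu\|_{\ell_2(\Lambda)}\le1}\|(\mu_\alpha\xi_\alpha)\|_{\ell_{\frac{2m}{m+1}}(\Lambda)}\le 2e^2\sqrt2\,\big(\sqrt{n\log(1+20m)}\,\|M_\xi\colon\mathcal P_{\le m}(\mathbb T^n)\to\ell_1(\Lambda)\|\big)^{\frac1m}\|\xi\|_\infty^{1-\frac1m}.$$ -/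

import Mathlib

open MeasureTheory

universe u

/-! ### Banach couples, interpolation functors and their fundamental functions -/

/-- A complex Banach space `B` with `B ↪ V`: the inclusion is an injective continuous linear map. -/
structure BanachSubspace (V : Type u) [AddCommGroup V] [Module ℂ V] [TopologicalSpace V] where
  carrier : Type u
  [normedAddCommGroup : NormedAddCommGroup carrier]
  [normedSpace : NormedSpace ℂ carrier]
  [completeSpace : CompleteSpace carrier]
  incl : carrier →L[ℂ] V
  incl_injective : Function.Injective incl

attribute [instance] BanachSubspace.normedAddCommGroup BanachSubspace.normedSpace
  BanachSubspace.completeSpace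

section BanachSubspace

variable {V W : Type u} [AddCommGroup V] [Module ℂ V] [TopologicalSpace V]
  [AddCommGroup W] [Module ℂ W] [TopologicalSpace W]

/-- `v ∈ B` and `‖v‖_B ≤ c`. -/
def BanachSubspace.NormLE (B : BanachSubspace V) (v : V) (c : ℝ) : Prop :=
  ∃ x : B.carrier, B.incl x = v ∧ ‖x‖ ≤ c

/-- `T` maps `A` (a subspace of the domain `S` of `T`) into `B`, and `‖T x‖_B ≤ c ‖x‖_A`
for all `x ∈ A`. -/
def BoundedBy {S : Submodule ℂ V} {S' : Submodule ℂ W} (T : S →ₗ[ℂ] S')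
    (A : BanachSubspace V) (B : BanachSubspace W) (c : ℝ) : Prop :=
  ∀ (x : A.carrier) (hx : A.incl x ∈ S), B.NormLE (T ⟨A.incl x, hx⟩ : W) (c * ‖x‖)

/-- The operator norm `‖T : A → B‖`, for `T` bounded from `A` to `B`. -/
noncomputable def operatorNorm {S : Submodule ℂ V} {S' : Submodule ℂ W} (T : S →ₗ[ℂ] S')
    (A : BanachSubspace V) (B : BanachSubspace W) : ℝ :=
  sInf {c : ℝ | 0 ≤ c ∧ BoundedBy T A B c}

end BanachSubspace

/-- A Banach couple: two Banach spaces continuously included in one Hausdorff topological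
vector space. -/
structure BanachCouple where
  ambient : Type u
  [addCommGroup : AddCommGroup ambient]
  [module : Module ℂ ambient]
  [topologicalSpace : TopologicalSpace ambient]
  [isTopologicalAddGroup : IsTopologicalAddGroup ambient]
  [continuousSMul : ContinuousSMul ℂ ambient]
  [t2Space : T2Space ambient]
  X₀ : BanachSubspace ambient
  X₁ : BanachSubspace ambient

attribute [instance] BanachCouple.addCommGroup BanachCouple.module
  BanachCouple.topologicalSpace BanachCouple.isTopologicalAddGroup
  BanachCouple.continuousSMul BanachCouple.t2Space

/-- The algebraic sum `X₀ + X₁`. -/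
def BanachCouple.sum (X : BanachCouple.{u}) : Submodule ℂ X.ambient :=
  LinearMap.range (X.X₀.incl : X.X₀.carrier →ₗ[ℂ] X.ambient) ⊔
    LinearMap.range (X.X₁.incl : X.X₁.carrier →ₗ[ℂ] X.ambient)

/-- An operator between Banach couples: a linear map `X₀ + X₁ → Y₀ + Y₁` whose restrictions
`X_j → Y_j` are defined and bounded. -/
structure CoupleOperator (X Y : BanachCouple.{u}) where
  toLinearMap : X.sum →ₗ[ℂ] Y.sum
  bounded₀ : ∃ c, BoundedBy toLinearMap X.X₀ Y.X₀ c
  bounded₁ : ∃ c, BoundedBy toLinearMap X.X₁ Y.X₁ c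

namespace CoupleOperator

variable {X Y : BanachCouple.{u}}

/-- `‖T : X₀ → Y₀‖`. -/
noncomputable def norm₀ (T : CoupleOperator X Y) : ℝ :=
  operatorNorm T.toLinearMap X.X₀ Y.X₀

/-- `‖T : X₁ → Y₁‖`. -/
noncomputable def norm₁ (T : CoupleOperator X Y) : ℝ :=
  operatorNorm T.toLinearMap X.X₁ Y.X₁

end CoupleOperator

/-- An interpolation functor on the class of all complex Banach couples. The fields `inter_le`
and `le_sum` are the continuous inclusions `X₀ ∩ X₁ ↪ F(X) ↪ X₀ + X₁`, for the norms
`max ‖x‖₀ ‖x‖₁` on the intersection and `inf (‖x₀‖ + ‖x₁‖)` on the sum. -/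
structure InterpolationFunctor where
  obj : ∀ X : BanachCouple.{u}, BanachSubspace X.ambient
  inter_le : ∀ X : BanachCouple.{u}, ∃ C : ℝ, ∀ (x₀ : X.X₀.carrier) (x₁ : X.X₁.carrier),
    X.X₀.incl x₀ = X.X₁.incl x₁ → (obj X).NormLE (X.X₀.incl x₀) (C * max ‖x₀‖ ‖x₁‖)
  le_sum : ∀ X : BanachCouple.{u}, ∃ C : ℝ, ∀ x : (obj X).carrier,
    ∃ (x₀ : X.X₀.carrier) (x₁ : X.X₁.carrier),
      (obj X).incl x = X.X₀.incl x₀ + X.X₁.incl x₁ ∧ ‖x₀‖ + ‖x₁‖ ≤ C * ‖x‖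
  bounded : ∀ (X Y : BanachCouple.{u}) (T : CoupleOperator X Y),
    ∃ c, BoundedBy T.toLinearMap (obj X) (obj Y) c

/-- The couple `(ℂ, ℂ)`. -/
noncomputable def scalarCouple : BanachCouple.{u} where
  ambient := ULift.{u} ℂ
  X₀ := ⟨ULift.{u} ℂ, .id ℂ _, Function.injective_id⟩
  X₁ := ⟨ULift.{u} ℂ, .id ℂ _, Function.injective_id⟩

namespace InterpolationFunctor

/-- `‖T : F(X) → F(Y)‖`. -/
noncomputable def mapNorm (F : InterpolationFunctor.{u}) {X Y : BanachCouple.{u}}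
    (T : CoupleOperator X Y) : ℝ :=
  operatorNorm T.toLinearMap (F.obj X) (F.obj Y)

/-- `F` is exact: `‖T : F(X) → F(Y)‖ ≤ max (‖T : X₀ → Y₀‖) (‖T : X₁ → Y₁‖)`. -/
def IsExact (F : InterpolationFunctor.{u}) : Prop :=
  ∀ (X Y : BanachCouple.{u}) (T : CoupleOperator X Y), F.mapNorm T ≤ max T.norm₀ T.norm₁

/-- `F` is normalized: the unit `1 ∈ ℂ` has norm at most one in `F(ℂ, ℂ)`. -/
def IsNormalized (F : InterpolationFunctor.{u}) : Prop :=
  (F.obj scalarCouple.{u}).NormLE (ULift.up (1 : ℂ) : ULift.{u} ℂ) 1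

/-- The fundamental function `ψ_F(s, t)`: the supremum of `‖T : F(X) → F(Y)‖` over all
operators `T` between Banach couples with `‖T : X₀ → Y₀‖ ≤ s` and `‖T : X₁ → Y₁‖ ≤ t`. For exact
`F` and `s, t ≥ 0` these norms are bounded by `max s t`. -/
noncomputable def fundamentalFunction (F : InterpolationFunctor.{u}) (s t : ℝ) : ℝ :=
  sSup {r : ℝ | ∃ (X Y : BanachCouple.{u}) (T : CoupleOperator X Y),
    T.norm₀ ≤ s ∧ T.norm₁ ≤ t ∧ r = F.mapNorm T}

end InterpolationFunctor

/-- The couple `(ℓ₁(ι), ℓ₂(ι))` for a finite index set `ι`, inside `ℂ^ι`. -/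
noncomputable def l1l2Couple (ι : Type u) [Fintype ι] : BanachCouple.{u} where
  ambient := ι → ℂ
  X₀ := ⟨PiLp 1 (fun _ : ι => ℂ), (PiLp.continuousLinearEquiv 1 ℂ (fun _ : ι => ℂ)),
    (PiLp.continuousLinearEquiv 1 ℂ (fun _ : ι => ℂ)).injective⟩
  X₁ := ⟨PiLp 2 (fun _ : ι => ℂ), (PiLp.continuousLinearEquiv 2 ℂ (fun _ : ι => ℂ)),
    (PiLp.continuousLinearEquiv 2 ℂ (fun _ : ι => ℂ)).injective⟩

/-- `v ↦ (∑ |v i| ^ p) ^ (1 / p)`. -/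
noncomputable def finiteLpNorm {ι : Type*} [Fintype ι] (p : ℝ) (v : ι → ℂ) : ℝ :=
  (∑ i, ‖v i‖ ^ p) ^ (1 / p)

/-! ### `λ`-embeddings -/

/-- `T` is a `λ`-embedding: an isomorphic embedding with `‖T‖ ‖T⁻¹‖ ≤ λ`, where `1 ≤ λ < ∞`
and `T⁻¹` is defined on the range of `T`; here `‖T⁻¹‖` is the least `K` such that
`‖x‖ ≤ K ‖T x‖` for all `x`. -/
def IsLambdaEmbedding {E E' : Type*} [NormedAddCommGroup E] [NormedSpace ℂ E]
    [NormedAddCommGroup E'] [NormedSpace ℂ E'] (lam : ℝ) (T : E →L[ℂ] E') : Prop :=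
  1 ≤ lam ∧ ∃ K : ℝ, 0 ≤ K ∧ (∀ x, ‖x‖ ≤ K * ‖T x‖) ∧ ‖T‖ * K ≤ lam

/-! ### Harmonic analysis on a compact abelian group -/

section CompactGroup

variable {G : Type*} [CommGroup G] [TopologicalSpace G] [IsTopologicalGroup G]
  [CompactSpace G] [MeasurableSpace G] [BorelSpace G]

variable (G) in
/-- The normalized Haar measure on a compact group. -/
noncomputable def normalizedHaar : Measure G :=
  Measure.haarMeasure (⊤ : TopologicalSpace.PositiveCompacts G)

instance : IsProbabilityMeasure (normalizedHaar G) :=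
  ⟨by simpa [normalizedHaar] using
    Measure.haarMeasure_self (K₀ := (⊤ : TopologicalSpace.PositiveCompacts G))⟩

theorem integrable_mul_conj_character (f : C(G, ℂ)) (γ : PontryaginDual G) :
    Integrable (fun g => f g * (starRingEnd ℂ) (γ g : ℂ)) (normalizedHaar G) := by
  refine Continuous.integrable_of_hasCompactSupport ?_ (HasCompactSupport.of_compactSpace _)
  have h : Continuous (fun g => (γ g : ℂ)) := by
    have : Continuous γ := map_continuous γ
    fun_prop
  have h2 : Continuous (fun g => (starRingEnd ℂ) (γ g : ℂ)) := Complex.continuous_conj.comp h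
  fun_prop

/-- The Fourier coefficient `f ↦ f̂(γ) = ∫ f(g) conj(γ(g)) dν(g)` on `C(G)`. -/
noncomputable def fourierCoefficient (γ : PontryaginDual G) : C(G, ℂ) →L[ℂ] ℂ :=
  LinearMap.mkContinuous
    { toFun := fun f => ∫ g, f g * (starRingEnd ℂ) (γ g : ℂ) ∂(normalizedHaar G)
      map_add' := fun f₁ f₂ => by
        rw [← integral_add (integrable_mul_conj_character f₁ γ)
          (integrable_mul_conj_character f₂ γ)]
        simp only [ContinuousMap.add_apply, add_mul]
      map_smul' := fun c f => by
        simp only [ContinuousMap.smul_apply, smul_eq_mul, mul_assoc, RingHom.id_apply]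
        exact integral_const_mul c _ }
    1 (fun f => by
      refine (norm_integral_le_of_norm_le_const (C := 1 * ‖f‖)
        (Filter.Eventually.of_forall fun g => ?_)).trans (by simp)
      have h : ‖(γ g : ℂ)‖ = 1 := Circle.norm_coe (γ g)
      rw [norm_mul, RCLike.norm_conj, h, mul_one, one_mul]
      exact f.norm_coe_le_norm g)

/-- `C_Γ`: the continuous functions on `G` whose Fourier coefficients vanish outside `Γ`, with
the sup norm. -/
noncomputable def spectralSubspace (Γ : Finset (PontryaginDual G)) : Submodule ℂ C(G, ℂ) where
  carrier := {f | ∀ γ, γ ∉ Γ → fourierCoefficient γ f = 0}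
  add_mem' := fun {f₁ f₂} h₁ h₂ γ hγ => by rw [map_add, h₁ γ hγ, h₂ γ hγ, add_zero]
  zero_mem' := fun γ _ => map_zero _
  smul_mem' := fun c f h γ hγ => by rw [map_smul, h γ hγ, smul_zero]

/-- The multiplier `M_ξ : C_Γ → ℓ₁(Γ)`, `f ↦ (ξ_γ f̂(γ))_{γ ∈ Γ}`. -/
noncomputable def multiplier (Γ : Finset (PontryaginDual G)) (ξ : Γ → ℂ) :
    spectralSubspace Γ →L[ℂ] PiLp 1 (fun _ : Γ => ℂ) :=
  ((PiLp.continuousLinearEquiv 1 ℂ (fun _ : Γ => ℂ)).symm :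
      (Γ → ℂ) →L[ℂ] PiLp 1 (fun _ : Γ => ℂ)).comp
    (ContinuousLinearMap.pi fun γ : Γ =>
      ξ γ • (fourierCoefficient (γ : PontryaginDual G)).comp (spectralSubspace Γ).subtypeL)

end CompactGroup

/-! ### Analytic polynomials on the torus -/

/-- The character `z ↦ z ^ α` of the torus `𝕋ⁿ`. -/
noncomputable def monomialCharacter {n : ℕ} (α : Fin n → ℕ) :
    PontryaginDual (Fin n → Circle) :=
  ({ toFun := fun z => ∏ i, z i ^ α i
     map_one' := by simp
     map_mul' := fun z w => by simp [mul_pow, Finset.prod_mul_distrib]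
     continuous_toFun := by fun_prop } : (Fin n → Circle) →ₜ* Circle)

open Classical in
/-- `Λ^≤(m, n)`: the characters `z ^ α` of `𝕋ⁿ` with `α ∈ ℕ₀ⁿ`, `|α| ≤ m`. The space
`spectralSubspace (analyticSpectrum m n)` consists of the analytic polynomials of degree at most
`m` in `n` variables. -/
noncomputable def analyticSpectrum (m n : ℕ) : Finset (PontryaginDual (Fin n → Circle)) :=
  ((Fintype.piFinset fun _ : Fin n => Finset.range (m + 1)).filter
    (fun α => ∑ i, α i ≤ m)).image monomialCharacter

/-! Everything rests on one estimate: multiplication by `ξ` maps `ℓ₂(Γ)` to `ℓ₁(Γ)` with norm at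
most `4λ √(1 + log N) ‖M_ξ‖`. Multiplying `μ` by unimodular `ε` does not change `∑ |ξ_γ μ_γ|`, which
is therefore at most `‖M_ξ‖` times the sup norm of `∑ ε_γ μ_γ γ`. In `ℓ_∞^N` this polynomial has `N`
coordinates, each a random sum with subgaussian tails, so a union bound yields signs that work for
all of them (`exists_sign_norm_sum_le`, `sum_norm_mul_le_of_embedding`).

On `ℓ₂` the same multiplication has norm at most `‖ξ‖_∞`. Hölder's inequality between `ℓ₁` and `ℓ₂`
then gives (b). For (a), with `s = √(1 + log N)`, the map `z ↦ z ξμ` factors as `(ℂ, ℂ) → (s ℓ₂, ℓ₂)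
→ (ℓ₁, ℓ₂)`; each arrow contributes one value of `ψ_F` (`normLE_l1l2Couple_mul`).

For (c), a grid of `(1 + 20m)^(2n)` points on the torus determines the sup norm up to a factor 2
(`exists_torus_net`) and plays the role of the coordinates. The slack between 4 and `e²√2` absorbs
the change from `1 + log N` to `n log (1 + 20m)`. -/

/-! ### Sums with random signs -/

/-- Exponential moments: the mean over all signs of `exp (t ∑ ε_i x_i)` is `∏ cosh (t x_i) ≤ exp
(t²/2)`. Summing over `k` before choosing the signs makes a single choice serve every `k`. -/
theorem exists_sign_sum_le {ι κ : Type*} [Fintype ι] [Fintype κ] [Nonempty κ] (x : κ → ι → ℝ)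
    (hx : ∀ k, ∑ i, x k i ^ 2 ≤ 1) {t : ℝ} (ht : 0 < t) :
    ∃ ε : ι → ℝ, (∀ i, |ε i| = 1) ∧
      ∀ k, ∑ i, ε i * x k i ≤ t / 2 + Real.log (Fintype.card κ) / t := by
  classical
  let s : Bool → ℝ := fun b => if b then 1 else -1
  have hmoment : ∀ k, ∑ e : ι → Bool, Real.exp (t * ∑ i, s (e i) * x k i) ≤
      2 ^ Fintype.card ι * Real.exp (t ^ 2 / 2) := by
    intro k
    have h1 : ∀ e : ι → Bool, Real.exp (t * ∑ i, s (e i) * x k i) =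
        ∏ i, Real.exp (t * (s (e i) * x k i)) := by
      intro e
      rw [Finset.mul_sum, Real.exp_sum]
    simp_rw [h1]
    rw [← Fintype.prod_sum (fun i (b : Bool) => Real.exp (t * (s b * x k i)))]
    have h2 : ∀ i, ∑ b : Bool, Real.exp (t * (s b * x k i)) ≤
        2 * Real.exp ((t * x k i) ^ 2 / 2) := by
      intro i
      have := Real.cosh_le_exp_half_sq (t * x k i)
      rw [Real.cosh_eq] at this
      simp only [Fintype.sum_bool, s]
      simp only [if_true, one_mul, Bool.false_eq_true, if_false, neg_mul, mul_neg]
      linarith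
    calc ∏ i, ∑ b : Bool, Real.exp (t * (s b * x k i))
        ≤ ∏ i, (2 * Real.exp ((t * x k i) ^ 2 / 2)) :=
          Finset.prod_le_prod (fun i _ => Finset.sum_nonneg fun b _ => (Real.exp_pos _).le)
            fun i _ => h2 i
      _ = 2 ^ Fintype.card ι * Real.exp (t ^ 2 / 2 * ∑ i, x k i ^ 2) := by
          rw [Finset.prod_mul_distrib, ← Real.exp_sum, Finset.mul_sum]
          simp only [Finset.prod_const, Finset.card_univ]
          congr 2
          exact Finset.sum_congr rfl fun i _ => by ring
      _ ≤ 2 ^ Fintype.card ι * Real.exp (t ^ 2 / 2) := by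
          gcongr
          exact mul_le_of_le_one_right (by positivity) (hx k)
  have htotal : ∑ e : ι → Bool, ∑ k, Real.exp (t * ∑ i, s (e i) * x k i) ≤
      ∑ _e : ι → Bool, Fintype.card κ * Real.exp (t ^ 2 / 2) := by
    rw [Finset.sum_comm]
    refine (Finset.sum_le_sum fun k _ => hmoment k).trans (le_of_eq ?_)
    simp
    ring
  obtain ⟨e, -, he⟩ := Finset.exists_le_of_sum_le Finset.univ_nonempty htotal
  refine ⟨fun i => s (e i), fun i => ?_, fun k => ?_⟩
  · cases h : e i <;> simp [s, h]
  · have hcard : (0 : ℝ) < Fintype.card κ := by exact_mod_cast Fintype.card_pos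
    have h3 : Real.exp (t * ∑ i, s (e i) * x k i) ≤ Fintype.card κ * Real.exp (t ^ 2 / 2) :=
      (Finset.single_le_sum (f := fun k => Real.exp (t * ∑ i, s (e i) * x k i))
        (fun _ _ => (Real.exp_pos _).le) (Finset.mem_univ k)).trans he
    have h4 := Real.log_le_log (Real.exp_pos _) h3
    rw [Real.log_exp, Real.log_mul hcard.ne' (Real.exp_pos _).ne', Real.log_exp] at h4
    have : t / 2 + Real.log (Fintype.card κ) / t =
        (Real.log (Fintype.card κ) + t ^ 2 / 2) / t := by
      field_simp
      ring
    rw [this, le_div_iff₀ ht]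
    linarith

/-- The real parts of `S, iS, -S, -iS` control `|Re S|` and `|Im S|`, so the one-sided real bound is
applied to the index set `κ × Fin 4`. -/
theorem exists_sign_norm_sum_le {ι κ : Type*} [Fintype ι] [Fintype κ] (a : κ → ι → ℂ)
    (ha : ∀ k, ∑ i, ‖a k i‖ ^ 2 ≤ 1) :
    ∃ ε : ι → ℂ, (∀ i, ‖ε i‖ = 1) ∧
      ∀ k, ‖∑ i, ε i * a k i‖ ≤ 4 * √(1 + Real.log (Fintype.card κ)) := by
  cases isEmpty_or_nonempty κ
  · exact ⟨fun _ => 1, by simp, fun k => isEmptyElim k⟩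
  set L : ℝ := 1 + Real.log (Fintype.card κ) with hL
  have hcard : (1 : ℝ) ≤ Fintype.card κ := by exact_mod_cast Fintype.card_pos (α := κ)
  have hL1 : 1 ≤ L := by linarith [Real.log_nonneg hcard]
  have hsq : √L * √L = L := Real.mul_self_sqrt (by linarith)
  have hs : 0 < √L := Real.sqrt_pos.2 (by linarith)
  obtain ⟨ε, hε, h⟩ := exists_sign_sum_le (κ := κ × Fin 4)
    (fun k i => (Complex.I ^ (k.2 : ℕ) * a k.1 i).re)
    (fun k => (Finset.sum_le_sum fun i _ => by
      rw [← sq_abs]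
      have := Complex.abs_re_le_norm (Complex.I ^ (k.2 : ℕ) * a k.1 i)
      rw [norm_mul, norm_pow, Complex.norm_I, one_pow, one_mul] at this
      gcongr).trans (ha k.1)) (t := 2 * √L) (by positivity)
  -- With `t = 2√L` both terms are at most `√L`, the second because `log (4|κ|) ≤ 2L`.
  have hbound : 2 * √L / 2 + Real.log (Fintype.card (κ × Fin 4)) / (2 * √L) ≤ 2 * √L := by
    have h4 : Real.log 4 ≤ 2 := by
      have : Real.log 4 = 2 * Real.log 2 := by
        rw [show (4 : ℝ) = 2 ^ 2 by norm_num, Real.log_pow]; norm_num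
      linarith [Real.log_two_lt_d9]
    have : Real.log (Fintype.card (κ × Fin 4)) ≤ 2 * L := by
      rw [Fintype.card_prod, Fintype.card_fin, Nat.cast_mul,
        Real.log_mul (by positivity) (by norm_num)]
      push_cast
      linarith [Real.log_nonneg hcard]
    have : Real.log (Fintype.card (κ × Fin 4)) / (2 * √L) ≤ √L := by
      rw [div_le_iff₀ (by positivity)]
      nlinarith
    linarith
  refine ⟨fun i => (ε i : ℂ), fun i => by simp [hε], fun k => ?_⟩
  have hrot : ∀ r : Fin 4, (Complex.I ^ (r : ℕ) * ∑ i, (ε i : ℂ) * a k i).re ≤ 2 * √L := by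
    intro r
    refine le_trans (le_of_eq ?_) ((h (k, r)).trans hbound)
    rw [Finset.mul_sum, Complex.re_sum]
    refine Finset.sum_congr rfl fun i _ => ?_
    rw [mul_left_comm, Complex.re_ofReal_mul]
  generalize ∑ i, (ε i : ℂ) * a k i = S at hrot ⊢
  have h0 : S.re ≤ 2 * √L := by simpa using hrot 0
  have h1 : -S.im ≤ 2 * √L := by simpa using hrot 1
  have h2 : -S.re ≤ 2 * √L := by simpa using hrot 2
  have h3 : S.im ≤ 2 * √L := by simpa [Complex.I_pow_three] using hrot 3
  have hre : |S.re| ≤ 2 * √L := abs_le.2 ⟨by linarith, h0⟩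
  have him : |S.im| ≤ 2 * √L := abs_le.2 ⟨by linarith, h3⟩
  linarith [Complex.norm_le_abs_re_add_abs_im S]

/-! ### Interpolation between `ℓ₁` and `ℓ₂` -/

/-- Hölder for `|v|^p = |v|^(p(1-θ)) |v|^(pθ)`; the reciprocals `p(1-θ)` and `pθ/2` of the two
exponents add up to 1. -/
theorem finiteLpNorm_le_interpolate {ι : Type*} [Fintype ι] (v : ι → ℂ) {θ p A B : ℝ}
    (hθ0 : 0 < θ) (hθ1 : θ < 1) (hp : 1 / p = (1 - θ) + θ / 2)
    (hA : ∑ i, ‖v i‖ ≤ A) (hB : √(∑ i, ‖v i‖ ^ 2) ≤ B) :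
    finiteLpNorm p v ≤ A ^ (1 - θ) * B ^ θ := by
  have hp0 : 0 < p := by
    have : 0 < 1 / p := by rw [hp]; linarith
    exact one_div_pos.1 this
  have hpm : p * (1 - θ) + p * θ / 2 = 1 := by
    have : p * (1 / p) = 1 := by field_simp
    rw [hp] at this
    linarith
  have hc1 : 0 < p * (1 - θ) := mul_pos hp0 (by linarith)
  have hc2 : 0 < p * θ / 2 := by positivity
  have hconj : (p * (1 - θ))⁻¹.HolderConjugate (p * θ / 2)⁻¹ :=
    Real.HolderConjugate.inv_inv hc1 hc2 hpm
  have hA0 : 0 ≤ ∑ i, ‖v i‖ := Finset.sum_nonneg fun i _ => norm_nonneg _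
  have hB0 : 0 ≤ ∑ i, ‖v i‖ ^ 2 := Finset.sum_nonneg fun i _ => by positivity
  have hH := Real.inner_le_Lp_mul_Lq Finset.univ (fun i => ‖v i‖ ^ (p * (1 - θ)))
    (fun i => ‖v i‖ ^ (p * θ)) hconj
  have hterm : ∀ i, ‖v i‖ ^ (p * (1 - θ)) * ‖v i‖ ^ (p * θ) = ‖v i‖ ^ p := by
    intro i
    rw [← Real.rpow_add_of_nonneg (norm_nonneg _) hc1.le (by positivity)]
    congr 1
    ring
  have hl : ∀ i, |‖v i‖ ^ (p * (1 - θ))| ^ (p * (1 - θ))⁻¹ = ‖v i‖ := by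
    intro i
    rw [abs_of_nonneg (by positivity), Real.rpow_rpow_inv (norm_nonneg _) hc1.ne']
  have hr : ∀ i, |‖v i‖ ^ (p * θ)| ^ (p * θ / 2)⁻¹ = ‖v i‖ ^ 2 := by
    intro i
    rw [abs_of_nonneg (by positivity), ← Real.rpow_mul (norm_nonneg _), ← Real.rpow_natCast]
    congr 1
    push_cast
    field_simp
  simp only [hterm, hl, hr, one_div, inv_inv] at hH
  calc finiteLpNorm p v
      ≤ ((∑ i, ‖v i‖) ^ (p * (1 - θ)) * (∑ i, ‖v i‖ ^ 2) ^ (p * θ / 2)) ^ (1 / p) := by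
        unfold finiteLpNorm
        exact Real.rpow_le_rpow (Finset.sum_nonneg fun i _ => by positivity) hH (by positivity)
    _ = (∑ i, ‖v i‖) ^ (1 - θ) * (√(∑ i, ‖v i‖ ^ 2)) ^ θ := by
        rw [Real.mul_rpow (by positivity) (by positivity), ← Real.rpow_mul hA0,
          ← Real.rpow_mul hB0, Real.sqrt_eq_rpow, ← Real.rpow_mul hB0]
        congr 2 <;> field_simp
    _ ≤ A ^ (1 - θ) * B ^ θ := by
        have : 0 ≤ A := hA0.trans hA
        gcongr

/-! ### Polynomials on the polydisc -/

/-- The one-variable maximum principle, one coordinate at a time; `S` in the induction is the set of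
coordinates already allowed inside the disc. -/
theorem norm_le_of_forall_mem_distinguishedBoundary {n : ℕ} {P : (Fin n → ℂ) → ℂ}
    (hP : Differentiable ℂ P) {ρ B : ℝ} (hρ : 0 < ρ)
    (hB : ∀ u : Fin n → ℂ, (∀ i, ‖u i‖ = ρ) → ‖P u‖ ≤ B) (u : Fin n → ℂ)
    (hu : ∀ i, ‖u i‖ ≤ ρ) : ‖P u‖ ≤ B := by
  classical
  have key : ∀ S : Finset (Fin n), ∀ u : Fin n → ℂ, (∀ i, ‖u i‖ ≤ ρ) →
      (∀ i, i ∉ S → ‖u i‖ = ρ) → ‖P u‖ ≤ B := by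
    intro S
    induction S using Finset.induction_on with
    | empty => exact fun u _ h => hB u fun i => h i (by simp)
    | insert j S hj ih =>
      intro u hu hS
      have hdiff : Differentiable ℂ fun ζ : ℂ => P (Function.update u j ζ) :=
        hP.comp fun ζ => (hasFDerivAt_update u ζ).differentiableAt
      have := Complex.norm_le_of_forall_mem_frontier_norm_le
        (U := Metric.ball (0 : ℂ) ρ) (f := fun ζ => P (Function.update u j ζ)) (C := B)
        Metric.isBounded_ball hdiff.diffContOnCl (fun ζ hζ => ?_) (z := u j) ?_
      · simpa using this
      · rw [frontier_ball _ hρ.ne', mem_sphere_zero_iff_norm] at hζ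
        refine ih _ (fun i => ?_) fun i hi => ?_
        · rcases eq_or_ne i j with rfl | h
          · simp [hζ]
          · simpa [h] using hu i
        · rcases eq_or_ne i j with rfl | h
          · simp [hζ]
          · simpa [h] using hS i (by simp [h, hi])
      · rw [closure_ball _ hρ.ne', mem_closedBall_zero_iff]
        exact hu j
  exact key Finset.univ u hu (by simp)

section Polynomial

variable {ι : Type*} [Fintype ι] {n m : ℕ} (c : ι → ℂ) (α : ι → Fin n → ℕ)

/-- The polynomial `u ↦ ∑ c_k u ^ (α_k)`. -/
noncomputable def polynomialSum (u : Fin n → ℂ) : ℂ := ∑ k, c k * ∏ i, u i ^ α k i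

theorem differentiable_polynomialSum : Differentiable ℂ (polynomialSum c α) := by
  unfold polynomialSum
  fun_prop

variable {c α}

/-- Since the degree is at most `m`, `ζ^(-m) P(ζv)` is a polynomial `q` in `1/ζ`. The maximum
principle for `q` on the unit disc is evaluated at `1/ρ`. -/
theorem norm_polynomialSum_smul_le (hα : ∀ k, ∑ i, α k i ≤ m) {S : ℝ}
    (hS : ∀ u : Fin n → ℂ, (∀ i, ‖u i‖ = 1) → ‖polynomialSum c α u‖ ≤ S) {ρ : ℝ} (hρ : 1 ≤ ρ)
    {v : Fin n → ℂ} (hv : ∀ i, ‖v i‖ = 1) :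
    ‖polynomialSum c α (fun i => ρ * v i)‖ ≤ ρ ^ m * S := by
  have hexp : ∀ ζ : ℂ, ζ ≠ 0 → polynomialSum c α (fun i => ζ * v i) =
      ζ ^ m * ∑ k, c k * (∏ i, v i ^ α k i) * ζ⁻¹ ^ (m - ∑ i, α k i) := by
    intro ζ hζ
    unfold polynomialSum
    rw [Finset.mul_sum]
    refine Finset.sum_congr rfl fun k _ => ?_
    have : ζ ^ m = ζ ^ (∑ i, α k i) * ζ ^ (m - ∑ i, α k i) := by
      rw [← pow_add, Nat.add_sub_cancel' (hα k)]
    simp only [mul_pow, Finset.prod_mul_distrib, Finset.prod_pow_eq_pow_sum]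
    rw [this, inv_pow]
    field_simp
  set q : ℂ → ℂ := fun ζ => ∑ k, c k * (∏ i, v i ^ α k i) * ζ ^ (m - ∑ i, α k i) with hq
  have hqd : Differentiable ℂ q := by
    rw [hq]
    fun_prop
  have hρ0 : (ρ : ℂ) ≠ 0 := by
    exact_mod_cast (by linarith : ρ ≠ 0)
  have := Complex.norm_le_of_forall_mem_frontier_norm_le
    (U := Metric.ball (0 : ℂ) 1) (f := q) (C := S)
    Metric.isBounded_ball hqd.diffContOnCl (fun ζ hζ => ?_) (z := (ρ : ℂ)⁻¹) ?_
  · rw [hexp _ hρ0, norm_mul, norm_pow, Complex.norm_real, Real.norm_of_nonneg (by linarith)]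
    gcongr
  · rw [frontier_ball _ one_ne_zero, mem_sphere_zero_iff_norm] at hζ
    have hζ0 : ζ⁻¹ ≠ 0 := inv_ne_zero (by rw [← norm_ne_zero_iff, hζ]; exact one_ne_zero)
    have h := hexp _ hζ0
    rw [inv_inv] at h
    have h2 := hS (fun i => ζ⁻¹ * v i) (fun i => by simp [hζ, hv])
    rwa [h, norm_mul, norm_pow, norm_inv, hζ, inv_one, one_pow, one_mul] at h2
  · rw [closure_ball _ one_ne_zero, mem_closedBall_zero_iff, norm_inv, Complex.norm_real,
      Real.norm_of_nonneg (by linarith)]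
    exact inv_le_one_of_one_le₀ hρ

/-- On the polydisc of radius `1 + 1/m` the polynomial is at most `(1 + 1/m)^m S ≤ 3S`. The line
through `z` and `w` stays there for parameters in the disc of radius 40, and the Schwarz lemma
bounds the variation at parameter 1 by `6S/40`. -/
theorem norm_polynomialSum_sub_le (hm : 1 ≤ m) (hα : ∀ k, ∑ i, α k i ≤ m) {S : ℝ}
    (hS : ∀ u : Fin n → ℂ, (∀ i, ‖u i‖ = 1) → ‖polynomialSum c α u‖ ≤ S)
    {z w : Fin n → ℂ} (hz : ∀ i, ‖z i‖ = 1) (hzw : ∀ i, ‖w i - z i‖ ≤ 1 / (40 * m)) :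
    ‖polynomialSum c α w - polynomialSum c α z‖ ≤ S / 2 := by
  have hm0 : (0 : ℝ) < m := by exact_mod_cast hm
  have hρ1 : (1 : ℝ) ≤ 1 + 1 / m := by
    have : 0 < 1 / (m : ℝ) := by positivity
    linarith
  have hS0 : 0 ≤ S := (norm_nonneg _).trans (hS (fun _ => 1) (by simp))
  have hlarge : ∀ u : Fin n → ℂ, (∀ i, ‖u i‖ ≤ 1 + 1 / (m : ℝ)) →
      ‖polynomialSum c α u‖ ≤ 3 * S := by
    intro u hu
    have h1 : ‖polynomialSum c α u‖ ≤ (1 + 1 / (m : ℝ)) ^ m * S := by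
      refine norm_le_of_forall_mem_distinguishedBoundary (differentiable_polynomialSum c α)
        (by linarith) (fun u hu => ?_) u hu
      have h0 : ((1 + 1 / (m : ℝ) : ℝ) : ℂ) ≠ 0 := by
        exact_mod_cast (by linarith : (1 + 1 / (m : ℝ)) ≠ 0)
      have := norm_polynomialSum_smul_le hα hS hρ1
        (v := fun i => ((1 + 1 / (m : ℝ) : ℝ) : ℂ)⁻¹ * u i) (fun i => by
          rw [norm_mul, norm_inv, Complex.norm_real, hu, Real.norm_of_nonneg (by linarith)]
          exact inv_mul_cancel₀ (by linarith))
      simpa only [mul_inv_cancel_left₀ h0] using this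
    have h2 : (1 + 1 / (m : ℝ)) ^ m < 3 := by
      have : (1 + 1 / (m : ℝ)) ^ m ≤ Real.exp (1 / m) ^ m := by
        gcongr
        linarith [Real.add_one_le_exp (1 / (m : ℝ))]
      rw [← Real.exp_nat_mul, mul_one_div_cancel hm0.ne'] at this
      linarith [Real.exp_one_lt_d9]
    exact h1.trans (by gcongr)
  set h : ℂ → ℂ := fun ζ => polynomialSum c α (fun i => z i + ζ * (w i - z i)) with hh
  have hd : Differentiable ℂ h :=
    (differentiable_polynomialSum c α).comp (by fun_prop)
  have hb : ∀ ζ ∈ Metric.ball (0 : ℂ) 40, ‖h ζ‖ ≤ 3 * S := by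
    intro ζ hζ
    rw [mem_ball_zero_iff] at hζ
    refine hlarge _ fun i => (norm_add_le _ _).trans ?_
    rw [hz, norm_mul]
    gcongr
    calc ‖ζ‖ * ‖w i - z i‖ ≤ 40 * (1 / (40 * m)) := by gcongr; exact hzw i
      _ = 1 / m := by field_simp
  have hmaps : Set.MapsTo h (Metric.ball 0 40) (Metric.closedBall (h 0) (6 * S)) := by
    intro ζ hζ
    rw [mem_closedBall_iff_norm]
    have h1 := hb ζ hζ
    have h2 := hb 0 (by simp)
    linarith [norm_sub_le (h ζ) (h 0)]
  have := Complex.dist_le_div_mul_dist_of_mapsTo_ball hd.differentiableOn hmaps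
    (z := 1) (by simp)
  simp only [hh, dist_eq_norm, one_mul, zero_mul, add_zero, sub_zero, norm_one, mul_one,
    add_sub_cancel] at this
  linarith

end Polynomial

theorem exists_circle_net {m : ℕ} (hm : 1 ≤ m) :
    ∃ w : Fin ((1 + 20 * m) ^ 2) → Circle, ∀ z : Circle, ∃ k,
      ‖(w k : ℂ) - (z : ℂ)‖ ≤ 1 / (40 * m) := by
  have hm1 : (1 : ℝ) ≤ m := by exact_mod_cast hm
  refine ⟨fun k => Circle.exp (k / (40 * m) - Real.pi), fun z => ?_⟩
  set t : ℝ := Complex.arg z with ht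
  have hπ := Real.pi_lt_d2
  have ht1 : -Real.pi < t := Complex.neg_pi_lt_arg _
  have ht2 : t ≤ Real.pi := Complex.arg_le_pi _
  have hs : 0 ≤ (t + Real.pi) * (40 * m) := mul_nonneg (by linarith) (by positivity)
  have hk : ⌊(t + Real.pi) * (40 * m)⌋₊ < (1 + 20 * m) ^ 2 := by
    rw [Nat.floor_lt hs]
    push_cast
    -- Spacing `1/(40m)` needs about `252m` points; the larger size `(1 + 20m)²` is chosen so that
    -- its logarithm is `2 log (1 + 20m)`.
    have : (t + Real.pi) * (40 * m) ≤ 6.3 * (40 * m) := by gcongr; linarith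
    nlinarith
  refine ⟨⟨_, hk⟩, ?_⟩
  have hz : (z : ℂ) = Complex.exp (t * Complex.I) := by
    have := Circle.exp_arg z
    rw [← Circle.coe_exp, ht, this]
  have h1 := Nat.floor_le hs
  have h2 := Nat.lt_floor_add_one ((t + Real.pi) * (40 * m))
  set k := ⌊(t + Real.pi) * (40 * m)⌋₊
  rw [hz, Circle.coe_exp]
  have h3 : Complex.exp (((k / (40 * m) - Real.pi : ℝ) : ℂ) * Complex.I) -
      Complex.exp (t * Complex.I) = Complex.exp (t * Complex.I) *
        (Complex.exp (Complex.I * ((k / (40 * m) - Real.pi - t : ℝ) : ℂ)) - 1) := by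
    rw [mul_sub, ← Complex.exp_add, mul_one]
    congr 2
    push_cast
    ring
  rw [h3, norm_mul, Complex.norm_exp_ofReal_mul_I, one_mul]
  refine (Real.norm_exp_I_mul_ofReal_sub_one_le).trans ?_
  have h40 : (0 : ℝ) < 40 * m := by positivity
  rw [Real.norm_eq_abs, abs_le]
  constructor
  · have : (t + Real.pi) - 1 / (40 * m) ≤ k / (40 * m) := by
      rw [le_div_iff₀ h40, sub_mul, one_div_mul_cancel h40.ne']
      linarith
    linarith
  · have : k / (40 * m) ≤ t + Real.pi := by
      rw [div_le_iff₀ h40]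
      exact h1
    have : 0 ≤ 1 / (40 * (m : ℝ)) := by positivity
    linarith

/-! ### Trigonometric polynomials on a compact abelian group -/

/-- A character of `G` as a complex valued continuous function. -/
noncomputable def characterMap {G : Type*} [CommGroup G] [TopologicalSpace G]
    (γ : PontryaginDual G) : C(G, ℂ) :=
  ⟨fun g => (γ g : ℂ), continuous_subtype_val.comp (map_continuous γ)⟩

theorem norm_characterMap_le {G : Type*} [CommGroup G] [TopologicalSpace G] [CompactSpace G]
    (γ : PontryaginDual G) : ‖characterMap γ‖ ≤ 1 :=
  (ContinuousMap.norm_le _ zero_le_one).2 fun g => (Circle.norm_coe (γ g)).le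

section CompactGroup

variable {G : Type*} [CommGroup G] [TopologicalSpace G] [IsTopologicalGroup G]
  [CompactSpace G] [MeasurableSpace G] [BorelSpace G]

/-- Translating by some `h` with `χ h ≠ 1` multiplies the integral by `χ h` yet leaves it unchanged.
-/
theorem integral_character_eq_zero {χ : PontryaginDual G} (hχ : χ ≠ 1) :
    ∫ g, (χ g : ℂ) ∂(normalizedHaar G) = 0 := by
  have : (normalizedHaar G).IsMulLeftInvariant := by
    unfold normalizedHaar
    infer_instance
  obtain ⟨h, hh⟩ : ∃ h, χ h ≠ 1 := by
    by_contra! H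
    exact hχ (DFunLike.ext _ _ H)
  have h1 := integral_mul_left_eq_self (μ := normalizedHaar G) (fun g => (χ g : ℂ)) h
  simp only [map_mul, Circle.coe_mul] at h1
  rw [integral_const_mul] at h1
  have h2 : ((χ h : ℂ) - 1) * ∫ g, (χ g : ℂ) ∂(normalizedHaar G) = 0 := by
    rw [sub_mul, h1, one_mul, sub_self]
  refine (mul_eq_zero.1 h2).resolve_left fun h3 => hh ?_
  exact Circle.ext (by simpa using sub_eq_zero.1 h3)

open Classical in
theorem fourierCoefficient_characterMap (γ γ' : PontryaginDual G) :
    fourierCoefficient γ (characterMap γ') = if γ = γ' then 1 else 0 := by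
  have h : fourierCoefficient γ (characterMap γ') =
      ∫ g, ((γ' / γ) g : ℂ) ∂(normalizedHaar G) := by
    change ∫ g, (γ' g : ℂ) * (starRingEnd ℂ) (γ g : ℂ) ∂(normalizedHaar G) = _
    refine integral_congr_ae (Filter.Eventually.of_forall fun g => ?_)
    change (γ' g : ℂ) * (starRingEnd ℂ) (γ g : ℂ) = ((γ' g / γ g : Circle) : ℂ)
    rw [div_eq_mul_inv, Circle.coe_mul, Circle.coe_inv_eq_conj]
  rw [h]
  split_ifs with hγ
  · subst hγ
    rw [div_self']
    change ∫ g, ((1 : Circle) : ℂ) ∂(normalizedHaar G) = 1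
    simp
  · exact integral_character_eq_zero fun h1 => hγ (div_eq_one.1 h1).symm

variable (Γ : Finset (PontryaginDual G))

theorem characterMap_mem_spectralSubspace (γ : Γ) :
    characterMap (γ : PontryaginDual G) ∈ spectralSubspace Γ := fun δ hδ => by
  rw [fourierCoefficient_characterMap, if_neg]
  rintro rfl
  exact hδ γ.2

/-- A character in `Γ` as an element of `C_Γ`. -/
noncomputable def spectralCharacter (γ : Γ) : spectralSubspace Γ :=
  ⟨characterMap (γ : PontryaginDual G), characterMap_mem_spectralSubspace Γ γ⟩

theorem norm_spectralCharacter_le (γ : Γ) : ‖spectralCharacter Γ γ‖ ≤ 1 :=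
  norm_characterMap_le _

/-- The trigonometric polynomial `∑ c_γ γ`. -/
noncomputable def trigPolynomial (c : Γ → ℂ) : spectralSubspace Γ :=
  ∑ γ, c γ • spectralCharacter Γ γ

theorem trigPolynomial_apply (c : Γ → ℂ) (g : G) :
    (trigPolynomial Γ c : C(G, ℂ)) g = ∑ γ : Γ, c γ * ((γ : PontryaginDual G) g : ℂ) := by
  simp only [trigPolynomial, Submodule.coe_sum, Submodule.coe_smul, ContinuousMap.coe_sum,
    Finset.sum_apply, ContinuousMap.coe_smul, Pi.smul_apply, smul_eq_mul]
  rfl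

theorem multiplier_trigPolynomial_apply (ξ c : Γ → ℂ) (γ : Γ) :
    multiplier Γ ξ (trigPolynomial Γ c) γ = ξ γ * c γ := by
  classical
  change ξ γ * fourierCoefficient (γ : PontryaginDual G) (trigPolynomial Γ c : C(G, ℂ)) = _
  congr 1
  simp only [trigPolynomial, Submodule.coe_sum, Submodule.coe_smul, map_sum, map_smul,
    spectralCharacter, fourierCoefficient_characterMap, smul_eq_mul, mul_ite, mul_one, mul_zero]
  rw [Finset.sum_eq_single γ]
  · simp
  · intro b _ hb
    rw [if_neg fun h => hb (Subtype.ext h.symm)]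
  · simp

theorem sum_norm_mul_le_norm_multiplier (ξ c : Γ → ℂ) :
    ∑ γ, ‖ξ γ * c γ‖ ≤ ‖multiplier Γ ξ‖ * ‖trigPolynomial Γ c‖ := by
  have h := (multiplier Γ ξ).le_opNorm (trigPolynomial Γ c)
  rw [PiLp.norm_eq_of_L1] at h
  simpa only [multiplier_trigPolynomial_apply] using h

/-- If every `μ` in the unit ball of `ℓ₂(Γ)` can be randomized to a trigonometric polynomial of
sup norm at most `B`, then multiplication by `ξ` maps `ℓ₂(Γ)` to `ℓ₁(Γ)` with norm at most
`B ‖M_ξ‖`. -/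
theorem sum_norm_mul_le_of_exists_sign (ξ : Γ → ℂ) {B : ℝ} {μ : Γ → ℂ}
    (hB : ∃ ε : Γ → ℂ, (∀ γ, ‖ε γ‖ = 1) ∧ ‖trigPolynomial Γ (fun γ => ε γ * μ γ)‖ ≤ B) :
    ∑ γ, ‖ξ γ * μ γ‖ ≤ B * ‖multiplier Γ ξ‖ := by
  obtain ⟨ε, hε, h⟩ := hB
  calc ∑ γ, ‖ξ γ * μ γ‖ = ∑ γ, ‖ξ γ * (ε γ * μ γ)‖ := by simp [hε]
    _ ≤ ‖multiplier Γ ξ‖ * ‖trigPolynomial Γ (fun γ => ε γ * μ γ)‖ :=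
      sum_norm_mul_le_norm_multiplier Γ ξ _
    _ ≤ B * ‖multiplier Γ ξ‖ := by
      rw [mul_comm]
      gcongr

theorem sum_norm_mul_le_of_embedding {N : ℕ} {lam : ℝ}
    {I : spectralSubspace Γ →L[ℂ] (Fin N → ℂ)} (hI : IsLambdaEmbedding lam I) (ξ : Γ → ℂ)
    {μ : Γ → ℂ} (hμ : ∑ γ, ‖μ γ‖ ^ 2 ≤ 1) :
    ∑ γ, ‖ξ γ * μ γ‖ ≤ 4 * lam * √(1 + Real.log N) * ‖multiplier Γ ξ‖ := by
  obtain ⟨hlam, K, hK0, hK, hIK⟩ := hI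
  have hlam0 : 0 < lam := by linarith
  -- Scaling by `K / lam` rather than by `1 / ‖I‖` needs no separate case for `I = 0`.
  have hcoord : ∀ j (γ : Γ), K / lam * ‖I (spectralCharacter Γ γ) j‖ ≤ 1 := by
    intro j γ
    have h1 : ‖I (spectralCharacter Γ γ) j‖ ≤ ‖I‖ :=
      (norm_le_pi_norm _ j).trans ((I.le_opNorm_of_le (norm_spectralCharacter_le Γ γ)).trans
        (by rw [mul_one]))
    calc K / lam * ‖I (spectralCharacter Γ γ) j‖ ≤ K / lam * ‖I‖ := by gcongr
      _ = ‖I‖ * K / lam := by ring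
      _ ≤ 1 := (div_le_one hlam0).2 hIK
  obtain ⟨ε, hε, h⟩ := exists_sign_norm_sum_le
    (fun (j : Fin N) (γ : Γ) => ((K / lam : ℝ) : ℂ) * I (spectralCharacter Γ γ) j * μ γ)
    (fun j => (Finset.sum_le_sum fun γ _ => by
      rw [norm_mul, norm_mul, Complex.norm_real, Real.norm_of_nonneg (by positivity), mul_pow]
      exact mul_le_of_le_one_left (by positivity)
        (pow_le_one₀ (by positivity) (hcoord j γ))).trans hμ)
  refine sum_norm_mul_le_of_exists_sign Γ ξ ⟨ε, hε, (hK _).trans ?_⟩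
  rw [Fintype.card_fin] at h
  have h2 : ‖((K / lam : ℝ) : ℂ) • I (trigPolynomial Γ fun γ => ε γ * μ γ)‖ ≤
      4 * √(1 + Real.log N) := by
    refine (pi_norm_le_iff_of_nonneg (by positivity)).2 fun j => le_trans (le_of_eq ?_) (h j)
    simp only [trigPolynomial, map_sum, map_smul, Pi.smul_apply, Finset.sum_apply, smul_eq_mul,
      Finset.mul_sum]
    congr 1
    exact Finset.sum_congr rfl fun γ _ => by ring
  rw [norm_smul, Complex.norm_real, Real.norm_of_nonneg (by positivity)] at h2
  calc K * ‖I (trigPolynomial Γ fun γ => ε γ * μ γ)‖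
      = lam * (K / lam * ‖I (trigPolynomial Γ fun γ => ε γ * μ γ)‖) := by field_simp
    _ ≤ lam * (4 * √(1 + Real.log N)) := by gcongr
    _ = 4 * lam * √(1 + Real.log N) := by ring

end CompactGroup

theorem sqrt_sum_norm_mul_sq_le {ι : Type*} [Fintype ι] (ξ μ : ι → ℂ)
    (hμ : ∑ i, ‖μ i‖ ^ 2 ≤ 1) : √(∑ i, ‖ξ i * μ i‖ ^ 2) ≤ ‖ξ‖ := by
  refine Real.sqrt_le_iff.2 ⟨norm_nonneg _, ?_⟩
  calc ∑ i, ‖ξ i * μ i‖ ^ 2 ≤ ∑ i, ‖ξ‖ ^ 2 * ‖μ i‖ ^ 2 := by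
        refine Finset.sum_le_sum fun i _ => ?_
        rw [norm_mul, mul_pow]
        gcongr
        exact norm_le_pi_norm ξ i
    _ ≤ ‖ξ‖ ^ 2 := by
        rw [← Finset.mul_sum]
        exact mul_le_of_le_one_right (by positivity) hμ

theorem four_le_exp_sq_mul_sqrt_two : 4 ≤ Real.exp 1 ^ 2 * √2 := by
  have h1 : (1 : ℝ) ≤ √2 := Real.one_le_sqrt.2 (by norm_num)
  nlinarith [Real.exp_one_gt_d9]

/-- The interpolated estimate for a multiplication operator bounded from `ℓ₂` to `ℓ₁`. -/
theorem finiteLpNorm_mul_le {ι : Type*} [Fintype ι] (ξ μ : ι → ℂ) (hμ : ∑ i, ‖μ i‖ ^ 2 ≤ 1)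
    {C R θ p : ℝ} (hC : 1 ≤ C) (hR : 0 ≤ R) (h1 : ∑ i, ‖ξ i * μ i‖ ≤ C * R)
    (hθ0 : 0 < θ) (hθ1 : θ < 1) (hp : 1 / p = (1 - θ) + θ / 2) :
    finiteLpNorm p (fun i => ξ i * μ i) ≤ C * R ^ (1 - θ) * ‖ξ‖ ^ θ := by
  refine (finiteLpNorm_le_interpolate _ hθ0 hθ1 hp h1 (sqrt_sum_norm_mul_sq_le ξ μ hμ)).trans ?_
  rw [Real.mul_rpow (by linarith) hR]
  gcongr
  -- Here `C ≥ 1` lets the constant leave the power `1 - θ`.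
  calc C ^ (1 - θ) ≤ C ^ (1 : ℝ) := Real.rpow_le_rpow_of_exponent_le hC (by linarith)
    _ = C := Real.rpow_one C

/-! ### Analytic polynomials on the torus -/

section Torus

variable {m n : ℕ} [MeasurableSpace (Fin n → Circle)] [BorelSpace (Fin n → Circle)]

/-- Every point has a grid point near enough that `f` changes by at most `‖f‖ / 2`. Hence `‖f‖ ≤ B +
‖f‖ / 2`. -/
theorem exists_torus_net (hm : 1 ≤ m) :
    ∃ w : (Fin n → Fin ((1 + 20 * m) ^ 2)) → Fin n → Circle,
      ∀ (c : analyticSpectrum m n → ℂ) (B : ℝ),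
        (∀ k, ‖(trigPolynomial _ c : C(Fin n → Circle, ℂ)) (w k)‖ ≤ B) →
          ‖trigPolynomial _ c‖ ≤ 2 * B := by
  obtain ⟨w, hw⟩ := exists_circle_net hm
  refine ⟨fun k i => w (k i), fun c B hB => ?_⟩
  have hspec : ∀ γ : analyticSpectrum m n, ∃ α : Fin n → ℕ, ∑ i, α i ≤ m ∧
      monomialCharacter α = (γ : PontryaginDual (Fin n → Circle)) := by
    rintro ⟨γ, hγ⟩
    simp only [analyticSpectrum, Finset.mem_image, Finset.mem_filter] at hγ
    obtain ⟨α, ⟨-, hα⟩, h⟩ := hγ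
    exact ⟨α, hα, h⟩
  choose α hα hγ using hspec
  set f : C(Fin n → Circle, ℂ) := (trigPolynomial _ c : C(Fin n → Circle, ℂ)) with hf
  have hfP : ∀ z : Fin n → Circle, f z = polynomialSum c α (fun i => (z i : ℂ)) := by
    intro z
    rw [hf, trigPolynomial_apply]
    refine Finset.sum_congr rfl fun γ _ => ?_
    rw [← hγ γ]
    change c γ * ((∏ i, z i ^ α γ i : Circle) : ℂ) = _
    congr 1
    exact (map_prod Circle.coeHom _ _).trans (Finset.prod_congr rfl fun i _ => map_pow _ _ _)
  have hS : ∀ u : Fin n → ℂ, (∀ i, ‖u i‖ = 1) → ‖polynomialSum c α u‖ ≤ ‖f‖ := by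
    intro u hu
    let z : Fin n → Circle := fun i => ⟨u i, mem_sphere_zero_iff_norm.2 (hu i)⟩
    have h := f.norm_coe_le_norm z
    rw [hfP z] at h
    exact h
  have hB0 : 0 ≤ B := (norm_nonneg _).trans (hB fun _ => ⟨0, by positivity⟩)
  have hhalf : ‖f‖ ≤ B + ‖f‖ / 2 := by
    refine (ContinuousMap.norm_le _ (by positivity)).2 fun z => ?_
    choose k hk using fun i => hw (z i)
    have h1 := norm_polynomialSum_sub_le hm hα hS (z := fun i => (z i : ℂ))
      (w := fun i => (w (k i) : ℂ)) (fun i => Circle.norm_coe _) hk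
    rw [← hfP z, ← hfP (fun i => w (k i))] at h1
    have h2 := hB k
    have h3 := norm_sub_norm_le (f z) (f fun i => w (k i))
    rw [norm_sub_rev] at h3
    linarith
  change ‖f‖ ≤ 2 * B
  linarith

theorem sum_norm_mul_le_of_analyticSpectrum (hm : 1 ≤ m) (hn : 1 ≤ n)
    (ξ μ : analyticSpectrum m n → ℂ) (hμ : ∑ γ, ‖μ γ‖ ^ 2 ≤ 1) :
    ∑ γ, ‖ξ γ * μ γ‖ ≤ 2 * Real.exp 1 ^ 2 * √2 *
      (√(n * Real.log (1 + 20 * m)) * ‖multiplier (analyticSpectrum m n) ξ‖) := by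
  obtain ⟨w, hw⟩ := exists_torus_net (n := n) hm
  obtain ⟨ε, hε, h⟩ := exists_sign_norm_sum_le
    (fun k (γ : analyticSpectrum m n) =>
      μ γ * ((γ : PontryaginDual (Fin n → Circle)) (w k) : ℂ))
    (fun k => by simpa only [norm_mul, Circle.norm_coe, mul_one] using hμ)
  have hnorm := hw (fun γ => ε γ * μ γ) _ fun k => by
    rw [trigPolynomial_apply]
    simpa only [mul_assoc] using h k
  refine (sum_norm_mul_le_of_exists_sign _ ξ ⟨ε, hε, hnorm⟩).trans ?_
  rw [← mul_assoc (2 * Real.exp 1 ^ 2 * √2)]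
  refine mul_le_mul_of_nonneg_right ?_ (by positivity)
  rw [show ∀ x, 2 * Real.exp 1 ^ 2 * √2 * x = 2 * (Real.exp 1 ^ 2 * √2 * x) from fun x => by ring]
  refine mul_le_mul_of_nonneg_left ?_ zero_le_two
  have hn1 : (1 : ℝ) ≤ n := by exact_mod_cast hn
  have hm1 : (1 : ℝ) ≤ m := by exact_mod_cast hm
  have hlog : 1 ≤ Real.log (1 + 20 * m) := by
    rw [Real.le_log_iff_exp_le (by positivity)]
    linarith [Real.exp_one_lt_d9]
  have hcard : Real.log (Fintype.card (Fin n → Fin ((1 + 20 * m) ^ 2))) =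
      2 * (n * Real.log (1 + 20 * m)) := by
    rw [Fintype.card_fun, Fintype.card_fin, Fintype.card_fin]
    push_cast
    rw [Real.log_pow, Real.log_pow]
    push_cast
    ring
  rw [hcard]
  set ℓ : ℝ := n * Real.log (1 + 20 * m) with hℓ
  have hℓ1 : 1 ≤ ℓ := by
    rw [hℓ]
    nlinarith
  -- The summand 1 is absorbed through `ℓ ≥ 1`, and `√48 ≤ e²√2` then finishes.
  have h4 : 4 * √(1 + 2 * ℓ) ≤ √(48 * ℓ) := by
    rw [show (4 : ℝ) = √16 by rw [show (16 : ℝ) = 4 ^ 2 by norm_num]; simp,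
      ← Real.sqrt_mul (by norm_num)]
    exact Real.sqrt_le_sqrt (by linarith)
  refine h4.trans ?_
  rw [Real.sqrt_mul (by norm_num)]
  gcongr
  refine (Real.sqrt_le_left (by positivity)).2 ?_
  rw [mul_pow, Real.sq_sqrt (by norm_num)]
  have : (2.7 : ℝ) ^ 2 ≤ Real.exp 1 ^ 2 := by
    gcongr
    linarith [Real.exp_one_gt_d9]
  nlinarith

end Torus

/-! ### Operators between Banach couples and fundamental functions -/

section BanachSubspace

variable {V W : Type u} [AddCommGroup V] [Module ℂ V] [TopologicalSpace V]
  [AddCommGroup W] [Module ℂ W] [TopologicalSpace W]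

theorem BanachSubspace.NormLE.mono {B : BanachSubspace V} {v : V} {c d : ℝ}
    (h : B.NormLE v c) (hcd : c ≤ d) : B.NormLE v d := by
  obtain ⟨x, hx, hxc⟩ := h
  exact ⟨x, hx, hxc.trans hcd⟩

theorem BanachSubspace.NormLE.smul {B : BanachSubspace V} {v : V} {c : ℝ}
    (h : B.NormLE v c) (a : ℂ) : B.NormLE (a • v) (‖a‖ * c) := by
  obtain ⟨x, hx, hxc⟩ := h
  refine ⟨a • x, by rw [map_smul, hx], ?_⟩
  rw [norm_smul]
  gcongr

variable {S : Submodule ℂ V} {S' : Submodule ℂ W} {T : S →ₗ[ℂ] S'}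
  {A : BanachSubspace V} {B : BanachSubspace W}

theorem operatorNorm_nonneg : 0 ≤ operatorNorm T A B :=
  Real.sInf_nonneg fun _ hc => hc.1

theorem operatorNorm_le {c : ℝ} (hc : 0 ≤ c) (h : BoundedBy T A B c) : operatorNorm T A B ≤ c :=
  csInf_le ⟨0, fun _ hd => hd.1⟩ ⟨hc, h⟩

/-- The infimum is attained: injectivity of `B.incl` makes the preimage of `T x` unique, so all
admissible constants bound the same norm. -/
theorem boundedBy_operatorNorm (h : ∃ c, BoundedBy T A B c) :
    BoundedBy T A B (operatorNorm T A B) := by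
  have hne : {c : ℝ | 0 ≤ c ∧ BoundedBy T A B c}.Nonempty := by
    obtain ⟨c, hc⟩ := h
    refine ⟨|c|, abs_nonneg c, fun x hx => (hc x hx).mono ?_⟩
    gcongr
    exact le_abs_self c
  intro x hx
  obtain ⟨c, hc⟩ := h
  obtain ⟨y, hy, -⟩ := hc x hx
  refine ⟨y, hy, ?_⟩
  rcases eq_or_ne x 0 with rfl | hx0
  · have h0 : (⟨A.incl 0, hx⟩ : S) = 0 := Subtype.ext (map_zero _)
    rw [h0, map_zero, Submodule.coe_zero, ← map_zero B.incl] at hy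
    rw [B.incl_injective hy]
    simp
  · rw [← div_le_iff₀ (norm_pos_iff.2 hx0)]
    refine le_csInf hne fun d hd => ?_
    obtain ⟨y', hy', hd'⟩ := hd.2 x hx
    rw [div_le_iff₀ (norm_pos_iff.2 hx0), B.incl_injective (hy.trans hy'.symm)]
    exact hd'

end BanachSubspace

namespace InterpolationFunctor

variable {F : InterpolationFunctor.{u}}

theorem incl_mem_sum (F : InterpolationFunctor.{u}) (X : BanachCouple.{u})
    (x : (F.obj X).carrier) : (F.obj X).incl x ∈ X.sum := by
  obtain ⟨C, hC⟩ := F.le_sum X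
  obtain ⟨x₀, x₁, hx, -⟩ := hC x
  rw [hx]
  exact Submodule.add_mem_sup ⟨x₀, rfl⟩ ⟨x₁, rfl⟩

theorem fundamentalFunction_nonneg (F : InterpolationFunctor.{u}) (s t : ℝ) :
    0 ≤ F.fundamentalFunction s t := by
  refine Real.sSup_nonneg ?_
  rintro r ⟨X, Y, T, -, -, rfl⟩
  exact operatorNorm_nonneg

theorem mapNorm_le_fundamentalFunction (hF : F.IsExact) {X Y : BanachCouple.{u}}
    (T : CoupleOperator X Y) {s t : ℝ} (hs : T.norm₀ ≤ s) (ht : T.norm₁ ≤ t) :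
    F.mapNorm T ≤ F.fundamentalFunction s t := by
  -- Exactness bounds the set above, so its real supremum is not the default value.
  refine le_csSup ⟨max s t, ?_⟩ ⟨X, Y, T, hs, ht, rfl⟩
  rintro r ⟨X, Y, T, hs, ht, rfl⟩
  exact (hF X Y T).trans (max_le_max hs ht)

/-- A linear map of the ambient spaces which is bounded by `s` from `X₀` to `Y₀` and by `t` from
`X₁` to `Y₁` is bounded by `ψ_F(s, t)` from `F(X)` to `F(Y)`. -/
theorem normLE_map (hF : F.IsExact) {X Y : BanachCouple.{u}} (T : X.ambient →ₗ[ℂ] Y.ambient)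
    {s t : ℝ} (hs : 0 ≤ s) (ht : 0 ≤ t)
    (h₀ : ∀ x, Y.X₀.NormLE (T (X.X₀.incl x)) (s * ‖x‖))
    (h₁ : ∀ x, Y.X₁.NormLE (T (X.X₁.incl x)) (t * ‖x‖)) {v : X.ambient} {c : ℝ}
    (hv : (F.obj X).NormLE v c) : (F.obj Y).NormLE (T v) (F.fundamentalFunction s t * c) := by
  have hmaps : ∀ x ∈ X.sum, T x ∈ Y.sum := by
    intro x hx
    obtain ⟨_, ⟨x₀, rfl⟩, _, ⟨x₁, rfl⟩, rfl⟩ := Submodule.mem_sup.1 hx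
    obtain ⟨y₀, hy₀, -⟩ := h₀ x₀
    obtain ⟨y₁, hy₁, -⟩ := h₁ x₁
    rw [map_add]
    exact Submodule.add_mem_sup ⟨y₀, hy₀⟩ ⟨y₁, hy₁⟩
  have hb₀ : BoundedBy (T.restrict hmaps) X.X₀ Y.X₀ s := fun x _ => h₀ x
  have hb₁ : BoundedBy (T.restrict hmaps) X.X₁ Y.X₁ t := fun x _ => h₁ x
  let U : CoupleOperator X Y := ⟨T.restrict hmaps, ⟨s, hb₀⟩, ⟨t, hb₁⟩⟩
  have hU : F.mapNorm U ≤ F.fundamentalFunction s t :=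
    mapNorm_le_fundamentalFunction hF U (operatorNorm_le hs hb₀) (operatorNorm_le ht hb₁)
  obtain ⟨x, rfl, hx⟩ := hv
  refine (boundedBy_operatorNorm (F.bounded X Y U) x (F.incl_mem_sum X x)).mono ?_
  exact mul_le_mul hU hx (norm_nonneg _) (F.fundamentalFunction_nonneg s t)

/-- The identity of `(ℂ, ℂ)` fixes a nonzero element of `F(ℂ, ℂ)`. This makes the factor `ψ_F(1, 1)`
in `K` harmless. -/
theorem one_le_fundamentalFunction_one_one (hF : F.IsExact) (hN : F.IsNormalized) :
    1 ≤ F.fundamentalFunction 1 1 := by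
  obtain ⟨x, hx, -⟩ := hN
  have hx0 : 0 < ‖x‖ := by
    rw [norm_pos_iff]
    rintro rfl
    rw [map_zero] at hx
    exact zero_ne_one (congrArg ULift.down hx)
  obtain ⟨y, hy, hyx⟩ := normLE_map hF (X := scalarCouple.{u}) (Y := scalarCouple.{u})
    LinearMap.id zero_le_one zero_le_one
    (fun z => ⟨z, rfl, (one_mul _).ge⟩) (fun z => ⟨z, rfl, (one_mul _).ge⟩)
    (⟨x, rfl, le_rfl⟩ : (F.obj scalarCouple.{u}).NormLE _ ‖x‖)
  rw [(F.obj scalarCouple).incl_injective hy] at hyx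
  exact (le_mul_iff_one_le_left hx0).1 hyx

end InterpolationFunctor

/-- The couple `(s ℓ₂(ι), ℓ₂(ι))`, where `s ℓ₂(ι)` carries the norm `s ‖·‖₂`. -/
noncomputable def weightedL2Couple (ι : Type u) [Fintype ι] (s : ℝ) (hs : 0 < s) :
    BanachCouple.{u} where
  ambient := ι → ℂ
  X₀ := ⟨PiLp 2 (fun _ : ι => ℂ),
    -- The weight sits in the inclusion: `v` is represented by `s v`, whose `ℓ₂` norm is `s ‖v‖₂`.
    ((s : ℂ)⁻¹ • (PiLp.continuousLinearEquiv 2 ℂ (fun _ : ι => ℂ) :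
      PiLp 2 (fun _ : ι => ℂ) →L[ℂ] (ι → ℂ))), by
      have : (s : ℂ)⁻¹ ≠ 0 := inv_ne_zero (Complex.ofReal_ne_zero.2 hs.ne')
      exact (smul_right_injective _ this).comp
        (PiLp.continuousLinearEquiv 2 ℂ (fun _ : ι => ℂ)).injective⟩
  X₁ := ⟨PiLp 2 (fun _ : ι => ℂ), (PiLp.continuousLinearEquiv 2 ℂ (fun _ : ι => ℂ)),
    (PiLp.continuousLinearEquiv 2 ℂ (fun _ : ι => ℂ)).injective⟩

/-- The operator `z ↦ z μ` from `(ℂ, ℂ)` to `(s ℓ₂, ℓ₂)`. -/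
theorem normLE_weightedL2Couple {F : InterpolationFunctor.{u}} (hF : F.IsExact)
    (hN : F.IsNormalized) {ι : Type u} [Fintype ι] {s : ℝ} (hs : 0 < s) (μ : EuclideanSpace ℂ ι)
    (hμ : ‖μ‖ ≤ 1) :
    (F.obj (weightedL2Couple ι s hs)).NormLE (fun i => μ i : ι → ℂ)
      (F.fundamentalFunction s 1) := by
  let T : ULift.{u} ℂ →ₗ[ℂ] (ι → ℂ) :=
    (LinearMap.toSpanSingleton ℂ (ι → ℂ) (fun i => μ i)).comp
      (ULift.moduleEquiv : ULift.{u} ℂ ≃ₗ[ℂ] ℂ).toLinearMap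
  have hT : ∀ z : ULift.{u} ℂ, T z = fun i => z.down * μ i := fun z => rfl
  have h := InterpolationFunctor.normLE_map hF (X := scalarCouple.{u})
    (Y := weightedL2Couple ι s hs) T hs.le zero_le_one (fun z => ?_) (fun z => ?_) hN
  · have h1 : T (ULift.up 1) = fun i => μ i := (hT _).trans (funext fun i => one_mul _)
    rw [← h1]
    exact h.mono (mul_one _).le
  · change ULift.{u} ℂ at z
    refine ⟨(s * z.down : ℂ) • μ, ?_, ?_⟩
    · funext i
      change (s : ℂ)⁻¹ * ((s * z.down : ℂ) * μ i) = z.down * μ i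
      have : (s : ℂ) ≠ 0 := Complex.ofReal_ne_zero.2 hs.ne'
      field_simp
    · change ‖(s * z.down : ℂ) • μ‖ ≤ s * ‖z.down‖
      rw [norm_smul, norm_mul, Complex.norm_real, Real.norm_of_nonneg hs.le]
      exact mul_le_of_le_one_right (by positivity) hμ
  · change ULift.{u} ℂ at z
    refine ⟨z.down • μ, rfl, ?_⟩
    change ‖z.down • μ‖ ≤ 1 * ‖z.down‖
    rw [norm_smul, one_mul]
    exact mul_le_of_le_one_right (norm_nonneg _) hμ

/-- A multiplication operator which is bounded from `ℓ₂` to `ℓ₁` maps the unit ball of `ℓ₂` to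
a bounded subset of `F(ℓ₁, ℓ₂)`. -/
theorem normLE_l1l2Couple_mul {F : InterpolationFunctor.{u}} (hF : F.IsExact)
    (hN : F.IsNormalized) {ι : Type u} [Fintype ι] {s : ℝ} (hs : 0 < s) (ξ : ι → ℂ) {C M : ℝ}
    (hC : 1 ≤ C) (hM : 0 ≤ M)
    (h : ∀ μ : ι → ℂ, ∑ i, ‖μ i‖ ^ 2 ≤ 1 → ∑ i, ‖ξ i * μ i‖ ≤ C * s * M)
    (μ : EuclideanSpace ℂ ι) (hμ : ‖μ‖ ≤ 1) :
    (F.obj (l1l2Couple ι)).NormLE (fun i => ξ i * μ i)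
      (C * (F.fundamentalFunction M ‖ξ‖ * F.fundamentalFunction s 1)) := by
  have hC0 : 0 < C := by linarith
  have hsum : ∀ x : EuclideanSpace ℂ ι, ∑ i, ‖ξ i * x i‖ ≤ C * s * M * ‖x‖ := by
    intro x
    rcases eq_or_ne x 0 with rfl | hx
    · simp
    have hx0 : 0 < ‖x‖ := norm_pos_iff.2 hx
    have h1 := h (fun i => (‖x‖ : ℂ)⁻¹ * x i) (by
      have : ∀ i, ‖(‖x‖ : ℂ)⁻¹ * x i‖ ^ 2 = (‖x‖ ^ 2)⁻¹ * ‖x i‖ ^ 2 := fun i => by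
        rw [norm_mul, norm_inv, Complex.norm_real, norm_norm, mul_pow, inv_pow]
      simp_rw [this]
      rw [← Finset.mul_sum, ← EuclideanSpace.norm_sq_eq]
      exact (inv_mul_cancel₀ (by positivity)).le)
    have h2 : ∀ i, ‖ξ i * ((‖x‖ : ℂ)⁻¹ * x i)‖ = ‖x‖⁻¹ * ‖ξ i * x i‖ := fun i => by
      rw [mul_left_comm, norm_mul, norm_inv, Complex.norm_real, norm_norm]
    simp_rw [h2] at h1
    rw [← Finset.mul_sum, inv_mul_le_iff₀ hx0] at h1
    linarith
  -- Dividing by `C` makes the endpoint norms at most `M` and `‖ξ‖`; homogeneity restores `C`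
  -- outside `ψ_F`.
  let T : (ι → ℂ) →ₗ[ℂ] (ι → ℂ) :=
    { toFun := fun x i => (C : ℂ)⁻¹ * (ξ i * x i)
      map_add' := fun x y => by
        funext i
        simp only [Pi.add_apply]
        ring
      map_smul' := fun a x => by
        funext i
        simp only [Pi.smul_apply, smul_eq_mul, RingHom.id_apply]
        ring }
  have hb := InterpolationFunctor.normLE_map hF (X := weightedL2Couple ι s hs)
    (Y := l1l2Couple ι) T hM (norm_nonneg ξ)
    (fun x => ?_) (fun x => ?_) (normLE_weightedL2Couple hF hN hs μ hμ)
  · have h3 := hb.smul (C : ℂ)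
    rw [Complex.norm_real, Real.norm_of_nonneg hC0.le] at h3
    have h4 : (fun i => ξ i * μ i) = (C : ℂ) • T (fun i => μ i) := funext fun i =>
      (mul_inv_cancel_left₀ (Complex.ofReal_ne_zero.2 hC0.ne') (ξ i * μ i)).symm
    rw [h4]
    exact h3
  · change EuclideanSpace ℂ ι at x
    refine ⟨WithLp.toLp 1 fun i => (C : ℂ)⁻¹ * (ξ i * ((s : ℂ)⁻¹ * x i)), rfl, ?_⟩
    change ‖(WithLp.toLp 1 fun i => (C : ℂ)⁻¹ * (ξ i * ((s : ℂ)⁻¹ * x i)) :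
      PiLp 1 fun _ : ι => ℂ)‖ ≤ M * ‖x‖
    rw [PiLp.norm_eq_of_L1]
    have h2 : ∀ i, ‖(C : ℂ)⁻¹ * (ξ i * ((s : ℂ)⁻¹ * x i))‖ = (C * s)⁻¹ * ‖ξ i * x i‖ := by
      intro i
      rw [mul_left_comm (ξ i), norm_mul, norm_mul, norm_inv, norm_inv, Complex.norm_real,
        Complex.norm_real, Real.norm_of_nonneg hC0.le, Real.norm_of_nonneg hs.le, mul_inv,
        mul_assoc]
    simp only [h2]
    rw [← Finset.mul_sum, inv_mul_le_iff₀ (by positivity)]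
    linarith [hsum x]
  · change EuclideanSpace ℂ ι at x
    refine ⟨WithLp.toLp 2 fun i => (C : ℂ)⁻¹ * (ξ i * x i), rfl, ?_⟩
    change ‖(WithLp.toLp 2 fun i => (C : ℂ)⁻¹ * (ξ i * x i) : EuclideanSpace ℂ ι)‖ ≤ ‖ξ‖ * ‖x‖
    rw [EuclideanSpace.norm_eq]
    refine Real.sqrt_le_iff.2 ⟨by positivity, ?_⟩
    rw [mul_pow, EuclideanSpace.norm_sq_eq, Finset.mul_sum]
    refine Finset.sum_le_sum fun i _ => ?_
    change ‖(C : ℂ)⁻¹ * (ξ i * x i)‖ ^ 2 ≤ _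
    rw [← mul_pow, norm_mul, norm_mul, norm_inv, Complex.norm_real, Real.norm_of_nonneg hC0.le]
    refine pow_le_pow_left₀ (by positivity) ?_ 2
    refine (mul_le_of_le_one_left (by positivity) (inv_le_one_of_one_le₀ hC)).trans ?_
    gcongr
    exact norm_le_pi_norm ξ i

theorem sum_norm_sq_le_one {ι : Type*} [Fintype ι] {μ : EuclideanSpace ℂ ι} (hμ : ‖μ‖ ≤ 1) :
    ∑ i, ‖μ i‖ ^ 2 ≤ 1 := by
  rw [← EuclideanSpace.norm_sq_eq]
  exact pow_le_one₀ (norm_nonneg _) hμ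

theorem mainTheorem7 :
    (∀ (G : Type u) [CommGroup G] [TopologicalSpace G] [IsTopologicalGroup G] [CompactSpace G]
        [T2Space G] [MeasurableSpace G] [BorelSpace G]
        (Γ : Finset (PontryaginDual G)) (N : ℕ) (lam : ℝ)
        (I : spectralSubspace Γ →L[ℂ] (Fin N → ℂ)) (_ : IsLambdaEmbedding lam I) (ξ : Γ → ℂ),
      (∀ F : InterpolationFunctor.{u}, F.IsExact → F.IsNormalized →
        ∀ μ : EuclideanSpace ℂ Γ, ‖μ‖ ≤ 1 →
          (F.obj (l1l2Couple Γ)).NormLE (fun γ => ξ γ * μ γ)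
            ((Real.exp 1 ^ 2 * lam * √2 * F.fundamentalFunction 1 1) *
              F.fundamentalFunction ‖multiplier Γ ξ‖ ‖ξ‖ *
              F.fundamentalFunction (√(1 + Real.log N)) 1)) ∧
      (∀ θ p : ℝ, 0 < θ → θ < 1 → 1 / p = (1 - θ) + θ / 2 →
        ∀ μ : EuclideanSpace ℂ Γ, ‖μ‖ ≤ 1 →
          finiteLpNorm p (fun γ => ξ γ * μ γ) ≤
            Real.exp 1 ^ 2 * lam * √2 *
              (√(1 + Real.log N) * ‖multiplier Γ ξ‖) ^ (1 - θ) * ‖ξ‖ ^ θ)) ∧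
    (∀ (m n : ℕ) [MeasurableSpace (Fin n → Circle)] [BorelSpace (Fin n → Circle)],
      1 ≤ m → 1 ≤ n → ∀ ξ : analyticSpectrum m n → ℂ,
      (∀ θ p : ℝ, 0 < θ → θ < 1 → 1 / p = (1 - θ) + θ / 2 →
        ∀ μ : EuclideanSpace ℂ (analyticSpectrum m n), ‖μ‖ ≤ 1 →
          finiteLpNorm p (fun γ => μ γ * ξ γ) ≤
            2 * Real.exp 1 ^ 2 * √2 *
              (√(n * Real.log (1 + 20 * m)) * ‖multiplier (analyticSpectrum m n) ξ‖) ^ (1 - θ) *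
              ‖ξ‖ ^ θ) ∧
      (∀ μ : EuclideanSpace ℂ (analyticSpectrum m n), ‖μ‖ ≤ 1 →
          finiteLpNorm (2 * m / (m + 1)) (fun γ => μ γ * ξ γ) ≤
            2 * Real.exp 1 ^ 2 * √2 *
              (√(n * Real.log (1 + 20 * m)) * ‖multiplier (analyticSpectrum m n) ξ‖) ^
                (1 / (m : ℝ)) *
              ‖ξ‖ ^ (1 - 1 / (m : ℝ)))) := by
  refine ⟨?_, ?_⟩
  · intro G _ _ _ _ _ _ _ Γ N lam I hI ξ
    have hlam : 1 ≤ lam := hI.1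
    have hlog : 0 ≤ Real.log N := Real.log_natCast_nonneg N
    have hC : 4 * lam ≤ Real.exp 1 ^ 2 * lam * √2 := by
      nlinarith [four_le_exp_sq_mul_sqrt_two]
    refine ⟨fun F hF hN μ hμ => ?_, fun θ p hθ0 hθ1 hp μ hμ => ?_⟩
    · refine (normLE_l1l2Couple_mul hF hN (s := √(1 + Real.log N)) (C := 4 * lam)
        (M := ‖multiplier Γ ξ‖) (Real.sqrt_pos.2 (by linarith)) ξ (by linarith) (by positivity)
        (fun μ hμ => sum_norm_mul_le_of_embedding Γ hI ξ hμ) μ hμ).mono ?_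
      rw [mul_assoc (_ * F.fundamentalFunction 1 1)]
      refine mul_le_mul_of_nonneg_right (hC.trans ?_) (mul_nonneg
        (F.fundamentalFunction_nonneg _ _) (F.fundamentalFunction_nonneg _ _))
      exact le_mul_of_one_le_right (by positivity)
        (InterpolationFunctor.one_le_fundamentalFunction_one_one hF hN)
    · have hμ' := sum_norm_sq_le_one hμ
      refine finiteLpNorm_mul_le ξ μ hμ' (by linarith) (by positivity)
        ((sum_norm_mul_le_of_embedding Γ hI ξ hμ').trans ?_) hθ0 hθ1 hp
      rw [mul_assoc (4 * lam)]
      exact mul_le_mul_of_nonneg_right hC (by positivity)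
  · intro m n _ _ hm hn ξ
    have hC : 1 ≤ 2 * Real.exp 1 ^ 2 * √2 := by
      linarith [four_le_exp_sq_mul_sqrt_two]
    have hmain : ∀ θ p : ℝ, 0 < θ → θ < 1 → 1 / p = (1 - θ) + θ / 2 →
        ∀ μ : EuclideanSpace ℂ (analyticSpectrum m n), ‖μ‖ ≤ 1 →
          finiteLpNorm p (fun γ => μ γ * ξ γ) ≤
            2 * Real.exp 1 ^ 2 * √2 *
              (√(n * Real.log (1 + 20 * m)) * ‖multiplier (analyticSpectrum m n) ξ‖) ^ (1 - θ) *
              ‖ξ‖ ^ θ := by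
      intro θ p hθ0 hθ1 hp μ hμ
      have hμ' := sum_norm_sq_le_one hμ
      simp_rw [mul_comm (μ _)]
      exact finiteLpNorm_mul_le ξ μ hμ' hC (by positivity)
        (sum_norm_mul_le_of_analyticSpectrum hm hn ξ μ hμ') hθ0 hθ1 hp
    refine ⟨hmain, fun μ hμ => ?_⟩
    -- The choice `θ = 1 - 1/m` gives `1/p = (m+1)/(2m)`, but for `m = 1` it is the excluded
    -- endpoint `θ = 0`, where the claim is the `ℓ₁` estimate itself.
    rcases hm.eq_or_lt with rfl | hm2
    · have h1 := sum_norm_mul_le_of_analyticSpectrum le_rfl hn ξ μ (sum_norm_sq_le_one hμ)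
      have hp : (2 * ((1 : ℕ) : ℝ) / (((1 : ℕ) : ℝ) + 1)) = 1 := by norm_num
      rw [hp]
      simp_rw [mul_comm (μ _)]
      simpa [finiteLpNorm] using h1
    · have hm2' : (1 : ℝ) < m := by exact_mod_cast hm2
      have h := hmain (1 - 1 / (m : ℝ)) (2 * m / (m + 1))
        (by rw [sub_pos, div_lt_one (by linarith)]; exact hm2')
        (by rw [sub_lt_self_iff]; positivity) (by field_simp; ring) μ hμ
      rwa [sub_sub_cancel] at h
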